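/- Fix $\gamma>\tfrac12$. For each $N$ let $M^N$ be an $N\times N$ complex block diagonal matrix whose diagonal blocks are $\ell=\ell(N)$ Jordan blocks $B^1,\dots,B^{\ell}$ (ones on the superdiagonal), where $B^i=B^i(N)$ has eigenvalue $c_i=c_i(N)\in\mathbb{C}$ and dimension $d_i=d_i(N)\ge 1$, with $\sum_{i=1}^{\ell} d_i=N$. Write $d_i=a_i\log N$ and put $r_i=\exp\big((-\gamma+\tfrac12)/a_i\big)$ and $$\mu_N=\sum_{i=1}^{\ell}\frac{d_i}{N}\,m_{c_i,r_i},$$ where $m_{c,r}$ is the uniform probability measure on the circle with center $c$ and radius $r$. Let $G^N$ be an $N\times N$ matrix of i.i.d. standard real normal variables and let $L_N$ be the empirical spectral measure of $M^N+N^{-\gamma}G^N$ (the eigenvalues being counted with algebraic multiplicity). For a compactly supported finite measure $\rho$ on $\mathbb{C}$ let $U_\rho(z)=\int_{\mathbb{C}}\log|z-x|\,d\rho(x)\in[-\infty,\infty)$; thus $U_{L_N}(z)=\frac1N\log\big|\det(M^N+N^{-\gamma}G^N-zI)\big|$. Assume that $\ell(N)=o(N)$. Then for every $z\in\mathbb{C}$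 and every $\delta>0$, $$\Pr\big[\,U_{L_N}(z)\ \ge\ U_{\mu_N}(z)+\delta\,\big]\longrightarrow 0\qquad (N\to\infty).$$ -/

import Mathlib

open MeasureTheory ProbabilityTheory Filter Topology
open scoped ENNReal

noncomputable section

/-- The `d × d` Jordan block with eigenvalue `c` (ones on the first superdiagonal). -/
def jordanBlock (d : ℕ) (c : ℂ) : Matrix (Fin d) (Fin d) ℂ :=
  Matrix.of fun i j => if i = j then c else if (i : ℕ) + 1 = (j : ℕ) then 1 else 0

/-- The data of an `N × N` matrix in Jordan form: the number `ℓ` of blocks, their dimensions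
(positive integers with sum `N`) and their eigenvalues. -/
structure JordanData (N : ℕ) where
  ℓ : ℕ
  dim : Fin ℓ → ℕ
  dim_pos : ∀ i, 0 < dim i
  sum_dim : ∑ i, dim i = N
  eig : Fin ℓ → ℂ

namespace JordanData

variable {N : ℕ} (B : JordanData N)

/-- The positions `0, …, N - 1`, listed block after block. -/
def index : (Σ i : Fin B.ℓ, Fin (B.dim i)) ≃ Fin N :=
  finSigmaFinEquiv.trans (finCongr B.sum_dim)

/-- The `N × N` block diagonal matrix whose diagonal blocks are the Jordan blocks. -/
def matrix : Matrix (Fin N) (Fin N) ℂ :=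
  Matrix.reindex B.index B.index
    (Matrix.blockDiagonal' fun i => jordanBlock (B.dim i) (B.eig i))

/-- The number `a_i` for which the `i`-th block has dimension `a_i log N`. -/
def a (i : Fin B.ℓ) : ℝ := (B.dim i : ℝ) / Real.log N

/-- The radius `r_i = exp ((-γ + 1/2) / a_i)`. -/
def radius (γ : ℝ) (i : Fin B.ℓ) : ℝ := Real.exp ((-γ + 1 / 2) / B.a i)

end JordanData

/-- The uniform probability measure on the circle with center `c` and radius `r`. -/
def uniformCircle (c : ℂ) (r : ℝ) : Measure ℂ :=
  Measure.map (circleMap c r)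
    ((ENNReal.ofReal (2 * Real.pi))⁻¹ • volume.restrict (Set.Ioc 0 (2 * Real.pi)))

/-- The measure `∑ i, (dim i / N) m_{c_i, r_i}`, where `dim i = a_i log N`. -/
def JordanData.circleMeasure {N : ℕ} (B : JordanData N) (γ : ℝ) : Measure ℂ :=
  ∑ i, ((B.dim i : ℝ≥0∞) / (N : ℝ≥0∞)) • uniformCircle (B.eig i) (B.radius γ i)

/-- The empirical spectral measure `(1/N) ∑ δ_{λ_i}`, the eigenvalues being counted with
algebraic multiplicity. -/
def empiricalSpectralMeasure {N : ℕ} (A : Matrix (Fin N) (Fin N) ℂ) : Measure ℂ :=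
  (N : ℝ≥0∞)⁻¹ • (A.charpoly.roots.map fun x => Measure.dirac x).sum

/-- The logarithmic potential `∫ log |z - x| dρ(x)` of a compactly supported finite measure, as
the integral of the positive part minus the integral of the negative part. Here `log 0 = -∞`, and
the value `-∞` is possible (for example at an atom of `ρ`). -/
def logPotential (ρ : Measure ℂ) (z : ℂ) : EReal :=
  ((∫⁻ x, (ENNReal.log ‖z - x‖ₑ).toENNReal ∂ρ : ℝ≥0∞) : EReal) -
    ((∫⁻ x, (-ENNReal.log ‖z - x‖ₑ).toENNReal ∂ρ : ℝ≥0∞) : EReal)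

/-- `G` is a random `N × N` matrix whose entries are i.i.d. standard (real) normal variables. -/
structure IsStdGaussianMatrix {Ω : Type*} [MeasurableSpace Ω] (P : Measure Ω) {N : ℕ}
    (G : Ω → Matrix (Fin N) (Fin N) ℝ) : Prop where
  hasLaw : ∀ i j, HasLaw (fun ω => G ω i j) (gaussianReal 0 1) P
  indep : iIndepFun (fun (p : Fin N × Fin N) ω => G ω p.1 p.2) P

/-- The noisy matrix `M + N^{-γ} G`. -/
def JordanData.noisy {N : ℕ} (B : JordanData N) (γ : ℝ) (G : Matrix (Fin N) (Fin N) ℝ) :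
    Matrix (Fin N) (Fin N) ℂ :=
  B.matrix + (((N : ℝ) ^ (-γ) : ℝ) : ℂ) • G.map Complex.ofReal

end

/-! The proof is Markov's inequality for the squared determinant. Put `A = M - z`, `ε = N ^ (-γ)`
and `t = N * ε ^ 2 = N ^ (1 - 2γ)`.

Second moment: `E |det (A + εG)|² ≤ det (A Aᴴ + t)`. As a function of one row, a Gram determinant is
a quadratic form whose leading part is at most `h` times the squared norm, with `h` the Gram
determinant of the other rows. Averaging over one centred entry of variance `ε ^ 2` thus costs no
more than adding `ε ^ 2` to that row's diagonal entry (`lintegral_det_gramAdd_single_le`). Doing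
this for all `N` entries of each row gives `t` (`lintegral_normSq_det_add_gaussian_le`).

The right side factors over the blocks. Each factor is a tridiagonal determinant solving a two-term
linear recurrence, and with `s = |c - z|²` it is at most `C(q) * ((1 + √t) ^ 2 / q) ^ d * max (s ^
d) t` for every `q < 1` (`det_jordanGram_re_le`).

The radii satisfy `r ^ (2d) = t` exactly, so the product of these maxima is `exp (2N U_μ(z))`
(`JordanData.exp_potential`). What remains is `C ^ ℓ * ((1 + √t) ^ 2 / q) ^ N`. Since `ℓ = o(N)` and
`t → 0`, taking `q` close to `1` makes this smaller than `exp (2Nδ)`. -/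

/-! ### Gram determinants as functions of a single row -/

section GramAdd

open Matrix
open scoped ComplexOrder

/-- The Gram matrix of the rows of `W`, with a real diagonal matrix added. -/
noncomputable def gramAdd {n κ : Type*} [Fintype κ] [DecidableEq n] (W : Matrix n κ ℂ)
    (D : n → ℝ) : Matrix n n ℂ :=
  W * Wᴴ + diagonal fun k => (D k : ℂ)

theorem gramAdd_posSemidef {n κ : Type*} [Fintype n] [Fintype κ] [DecidableEq n]
    (W : Matrix n κ ℂ) {D : n → ℝ} (hD : ∀ k, 0 ≤ D k) : (gramAdd W D).PosSemidef := by
  refine (posSemidef_self_mul_conjTranspose W).add (PosSemidef.diagonal ?_)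
  intro k
  simpa using hD k

theorem det_gramAdd_submatrix {m n κ : Type*} [Fintype m] [Fintype n] [Fintype κ]
    [DecidableEq m] [DecidableEq n] (W : Matrix n κ ℂ) (D : n → ℝ) (e : m ≃ n) :
    (gramAdd (W.submatrix e id) (D ∘ e)).det = (gramAdd W D).det := by
  rw [← det_submatrix_equiv_self e]
  congr 1
  ext a b
  simp [gramAdd, mul_apply, diagonal_apply]

/-- The matrix `V` with one more row `w`. -/
def sumRow {m κ : Type*} (V : Matrix m κ ℂ) (w : κ → ℂ) : Matrix (m ⊕ Unit) κ ℂ :=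
  Matrix.of fun a b => Sum.elim (fun k => V k b) (fun _ => w b) a

theorem gramAdd_sumElim {m κ : Type*} [Fintype m] [Fintype κ] [DecidableEq m]
    (V : Matrix m κ ℂ) (w : κ → ℂ) (D : m → ℝ) (d : ℝ) :
    gramAdd (sumRow V w) (Sum.elim D fun _ : Unit => d) =
      fromBlocks (gramAdd V D) (replicateCol Unit (V *ᵥ star w))
        (replicateCol Unit (V *ᵥ star w))ᴴ (Matrix.of fun _ _ => w ⬝ᵥ star w + d) := by
  ext a b
  rcases a with a | a <;> rcases b with b | b <;>
    simp [gramAdd, sumRow, mul_apply, diagonal_apply, mulVec, dotProduct, mul_comm]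

/-- A kernel vector of `H`, extended by zero, is isotropic for the whole form, and isotropic vectors
of a positive semidefinite form lie in its kernel. -/
theorem det_fromBlocks_eq_zero_of_posSemidef {m : Type*} [Fintype m] [DecidableEq m]
    {H : Matrix m m ℂ} {B : Matrix m Unit ℂ} {C : Matrix Unit m ℂ} {E : Matrix Unit Unit ℂ}
    (hM : (fromBlocks H B C E).PosSemidef) (hH : H.det = 0) : (fromBlocks H B C E).det = 0 := by
  obtain ⟨v, hv, hHv⟩ := exists_mulVec_eq_zero_iff.2 hH
  refine exists_mulVec_eq_zero_iff.1 ⟨Sum.elim v 0, ?_, ?_⟩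
  · intro h
    exact hv (funext fun k => congrFun h (Sum.inl k))
  · rw [← hM.dotProduct_mulVec_zero_iff, fromBlocks_mulVec]
    simp [dotProduct, hHv]

/-- The determinant of a Gram matrix as a quadratic form in one of its vectors. -/
theorem exists_det_gramAdd_eq {m κ : Type*} [Fintype m] [Fintype κ] [DecidableEq m]
    (V : Matrix m κ ℂ) {D : m → ℝ} (hD : ∀ k, 0 ≤ D k) :
    ∃ h : ℝ, 0 ≤ h ∧ ∃ K : Matrix m m ℂ, K.PosSemidef ∧ ∀ (w : κ → ℂ) (d : ℝ), 0 ≤ d →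
      (gramAdd (sumRow V w) (Sum.elim D fun _ : Unit => d)).det.re =
        h * ((w ⬝ᵥ star w).re + d - (star (V *ᵥ star w) ⬝ᵥ K *ᵥ (V *ᵥ star w)).re) := by
  have hH := gramAdd_posSemidef V hD
  by_cases h0 : (gramAdd V D).det = 0
  -- If the other rows are already degenerate, the determinant vanishes for every new row.
  · refine ⟨0, le_rfl, 0, PosSemidef.zero, fun w d hd => ?_⟩
    have hM := gramAdd_posSemidef (sumRow V w)
      (D := Sum.elim D fun _ => d) (by rintro (k | k) <;> simp [hD, hd])
    rw [gramAdd_sumElim] at hM ⊢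
    rw [det_fromBlocks_eq_zero_of_posSemidef hM h0]
    simp
  -- Otherwise the formula is the Schur complement, with `K` the inverse of the old Gram matrix.
  · have hre := Complex.nonneg_iff.1 hH.det_nonneg
    refine ⟨(gramAdd V D).det.re, hre.1, (gramAdd V D)⁻¹, hH.inv, fun w d _ => ?_⟩
    let : Invertible (gramAdd V D) :=
      (gramAdd V D).invertibleOfIsUnitDet (isUnit_iff_ne_zero.2 h0)
    rw [gramAdd_sumElim, det_fromBlocks₁₁, Complex.mul_re, ← hre.2, zero_mul, sub_zero]
    congr 1
    simp only [invOf_eq_nonsing_inv, det_unique, Matrix.sub_apply, of_apply, Complex.sub_re,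
      Complex.add_re, Complex.ofReal_re]
    congr 2
    generalize V *ᵥ star w = u
    rw [Matrix.mul_assoc]
    simp [mul_apply, mulVec, dotProduct]

/-- Symmetric noise in one entry raises the determinant of a Gram matrix at most as much as a
diagonal term does. -/
theorem exists_det_gramAdd_single {n κ : Type*} [Fintype n] [Fintype κ] [DecidableEq n]
    [DecidableEq κ] (W : Matrix n κ ℂ) {D : n → ℝ} (hD : ∀ k, 0 ≤ D k) (i : n) (j : κ) :
    ∃ h : ℝ, 0 ≤ h ∧
      (∀ g : ℝ, (gramAdd (W + single i j (g : ℂ)) D).det.re +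
        (gramAdd (W + single i j ((-g : ℝ) : ℂ)) D).det.re ≤
          2 * (gramAdd W D).det.re + 2 * g ^ 2 * h) ∧
      ∀ e : ℝ, 0 ≤ e → (gramAdd W (D + Pi.single i e)).det.re = (gramAdd W D).det.re + e * h := by
  classical
  let e : {k // k ≠ i} ⊕ Unit ≃ n :=
    (Equiv.optionEquivSumPUnit _).symm.trans (Equiv.optionSubtypeNe i)
  let V : Matrix {k // k ≠ i} κ ℂ := Matrix.of fun k b => W k b
  have key : ∀ (w : κ → ℂ) (d : ℝ), (gramAdd (W.updateRow i w) (Function.update D i d)).det =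
      (gramAdd (sumRow V w) (Sum.elim (fun k : {k // k ≠ i} => D k) fun _ : Unit => d)).det := by
    intro w d
    rw [← det_gramAdd_submatrix _ _ e]
    congr 2
    · ext (a | a) b
      · simp [e, sumRow, V, a.2]
      · simp [e, sumRow]
    · ext (a | a)
      · simp [e, a.2]
      · simp [e]
  obtain ⟨h, h0, K, hK, hdet⟩ := exists_det_gramAdd_eq V (D := fun k => D k) fun k => hD k
  have hrow : ∀ g : ℝ, (gramAdd (W + single i j (g : ℂ)) D).det =
      (gramAdd (W.updateRow i (W i + Pi.single j (g : ℂ))) (Function.update D i (D i))).det := by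
    intro g
    rw [Function.update_eq_self]
    congr 2
    ext a b
    rcases eq_or_ne a i with rfl | ha
    · simp [single_apply, Pi.single_apply, eq_comm]
    · simp [ha, ha.symm]
  have hW : (gramAdd W D).det = (gramAdd (W.updateRow i (W i)) (Function.update D i (D i))).det := by
    simp
  refine ⟨h, h0, fun g => ?_, fun t ht => ?_⟩
  · rw [hrow, hrow, hW, key, key, key, hdet _ _ (hD i), hdet _ _ (hD i), hdet _ _ (hD i)]
    -- The terms linear in `g` cancel between `g` and `-g`. The quadratic term is `2 g² h` minus `2
    -- g² h` times this quantity, so its sign gives the bound.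
    have hKj := (Complex.nonneg_iff.1 (hK.dotProduct_mulVec_nonneg
      (V *ᵥ star (Pi.single j (1 : ℂ))))).1
    have hs : ∀ x : ℝ, (Pi.single j (x : ℂ) : κ → ℂ) = (x : ℂ) • Pi.single j (1 : ℂ) := by
      intro x; ext b; simp [Pi.single_apply]
    have hone : ((Pi.single j (1 : ℂ) : κ → ℂ) ⬝ᵥ star (Pi.single j (1 : ℂ))) = 1 := by
      simp
    rw [hs, hs]
    generalize (Pi.single j (1 : ℂ) : κ → ℂ) = v at *
    have e1 : ∀ x : ℝ, V *ᵥ star (W i + (x : ℂ) • v) = V *ᵥ star (W i) + (x : ℂ) • V *ᵥ star v := by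
      intro x; simp [mulVec_add, mulVec_smul]
    rw [e1, e1]
    generalize V *ᵥ star v = q at *
    generalize V *ᵥ star (W i) = p at *
    simp only [star_add, star_smul, add_dotProduct, dotProduct_add, mulVec_add, mulVec_smul,
      smul_dotProduct, dotProduct_smul, smul_eq_mul, hone, RCLike.star_def, Complex.conj_ofReal,
      Complex.add_re, Complex.re_ofReal_mul, Complex.one_re]
    nlinarith [mul_nonneg (mul_nonneg h0 (sq_nonneg g)) hKj]
  · have hD' : D + Pi.single i t = Function.update D i (D i + t) := by
      ext a
      rcases eq_or_ne a i with rfl | ha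
      · simp
      · simp [ha]
    have hW' : (gramAdd W (D + Pi.single i t)).det =
        (gramAdd (W.updateRow i (W i)) (Function.update D i (D i + t))).det := by
      simp [hD']
    rw [hW', hW, key, key, hdet _ _ (hD i), hdet _ _ (add_nonneg (hD i) ht)]
    ring

end GramAdd

/-! ### Second moment of the determinant under Gaussian noise -/

section SecondMoment

open Matrix
open scoped ComplexOrder

theorem det_gramAdd_re_nonneg {n κ : Type*} [Fintype n] [Fintype κ] [DecidableEq n]
    (W : Matrix n κ ℂ) {D : n → ℝ} (hD : ∀ k, 0 ≤ D k) : 0 ≤ (gramAdd W D).det.re :=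
  (Complex.nonneg_iff.1 (gramAdd_posSemidef W hD).det_nonneg).1

theorem Continuous.det_gramAdd_re {X n κ : Type*} [TopologicalSpace X] [Fintype n] [Fintype κ]
    [DecidableEq n] {W : X → Matrix n κ ℂ} (hW : Continuous W) (D : n → ℝ) :
    Continuous fun x => (gramAdd (W x) D).det.re := by
  unfold gramAdd
  exact Complex.continuous_re.comp
    (((hW.matrix_mul hW.matrix_conjTranspose).add continuous_const).matrix_det)

theorem integral_sq_gaussianReal : ∫ x, x ^ 2 ∂gaussianReal 0 1 = 1 := by
  have h := variance_id_gaussianReal (μ := 0) (v := 1)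
  rw [variance_of_integral_eq_zero (by fun_prop) (by simp)] at h
  simpa using h

theorem integrable_sq_gaussianReal : Integrable (fun x : ℝ => x ^ 2) (gaussianReal 0 1) :=
  (memLp_id_gaussianReal 2).integrable_sq

/-- Integrating over a Gaussian entry costs at most a diagonal term. -/
theorem lintegral_det_gramAdd_single_le {n κ : Type*} [Fintype n] [Fintype κ] [DecidableEq n]
    [DecidableEq κ] (W : Matrix n κ ℂ) {D : n → ℝ} (hD : ∀ k, 0 ≤ D k) (i : n) (j : κ) (ε : ℝ) :
    ∫⁻ x, ENNReal.ofReal (gramAdd (W + single i j ((ε * x : ℝ) : ℂ)) D).det.re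
        ∂gaussianReal 0 1 ≤
      ENNReal.ofReal (gramAdd W (D + Pi.single i (ε ^ 2))).det.re := by
  obtain ⟨h, h0, hle, heq⟩ := exists_det_gramAdd_single W hD i j
  rw [heq _ (sq_nonneg ε)]
  set p : ℝ → ℝ := fun x => (gramAdd (W + single i j ((ε * x : ℝ) : ℂ)) D).det.re with hp
  have hpc : Continuous p := by
    refine Continuous.det_gramAdd_re (continuous_const.add ?_) D
    refine continuous_matrix fun a b => ?_
    simp only [single_apply]
    split_ifs <;> fun_prop
  have hp0 : ∀ x, 0 ≤ p x := fun x => det_gramAdd_re_nonneg _ hD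
  have hα := det_gramAdd_re_nonneg W hD
  -- Symmetry of the Gaussian allows `p x` to be averaged with `p (-x)`, which is the quantity
  -- bounded by `hle`.
  have hsymm : ∫⁻ x, ENNReal.ofReal (p x) ∂gaussianReal 0 1 =
      ∫⁻ x, ENNReal.ofReal (p (-x)) ∂gaussianReal 0 1 := by
    have hm : (gaussianReal 0 1).map (fun x : ℝ => -x) = gaussianReal 0 1 := by
      simpa using gaussianReal_map_neg (μ := 0) (v := 1)
    conv_lhs => rw [← hm]
    rw [lintegral_map (by fun_prop) (by fun_prop)]
  have hint : Integrable (fun x : ℝ => 2 * (gramAdd W D).det.re + 2 * ε ^ 2 * h * x ^ 2)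
      (gaussianReal 0 1) :=
    (integrable_const _).add (integrable_sq_gaussianReal.const_mul _)
  have h2 : 2 * ∫⁻ x, ENNReal.ofReal (p x) ∂gaussianReal 0 1 ≤
      2 * ENNReal.ofReal ((gramAdd W D).det.re + ε ^ 2 * h) := by
    calc 2 * ∫⁻ x, ENNReal.ofReal (p x) ∂gaussianReal 0 1
        = ∫⁻ x, ENNReal.ofReal (p x + p (-x)) ∂gaussianReal 0 1 := by
          rw [two_mul]
          nth_rewrite 2 [hsymm]
          rw [← lintegral_add_left (by fun_prop)]
          simp only [ENNReal.ofReal_add (hp0 _) (hp0 _)]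
      _ ≤ ∫⁻ x, ENNReal.ofReal (2 * (gramAdd W D).det.re + 2 * ε ^ 2 * h * x ^ 2)
            ∂gaussianReal 0 1 := by
          refine lintegral_mono fun x => ENNReal.ofReal_le_ofReal ?_
          have := hle (ε * x)
          simp only [hp, mul_neg]
          linarith [this]
      _ = ENNReal.ofReal (2 * ((gramAdd W D).det.re + ε ^ 2 * h)) := by
          rw [← ofReal_integral_eq_lintegral_ofReal hint
            (ae_of_all _ fun x => by positivity)]
          rw [integral_add (integrable_const _) (integrable_sq_gaussianReal.const_mul _),
            integral_const_mul (2 * ε ^ 2 * h), integral_sq_gaussianReal]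
          rw [integral_const, probReal_univ, one_smul]
          ring_nf
      _ = 2 * ENNReal.ofReal ((gramAdd W D).det.re + ε ^ 2 * h) := by
          rw [ENNReal.ofReal_mul (by norm_num)]
          simp
  exact (ENNReal.mul_le_mul_iff_right (by norm_num) (by norm_num)).1 h2

/-- `A` plus `ε` times the matrix with the entries `x` outside `S` and `0` in `S`. -/
noncomputable def partialNoise {n κ : Type*} [DecidableEq n] [DecidableEq κ] (A : Matrix n κ ℂ)
    (ε : ℝ) (S : Finset (n × κ)) (x : n × κ → ℝ) : Matrix n κ ℂ :=
  A + Matrix.of fun i j => if (i, j) ∈ S then 0 else ((ε * x (i, j) : ℝ) : ℂ)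

/-- `ε ^ 2` times the number of positions of `S` in each row. -/
noncomputable def rowWeight {n κ : Type*} [DecidableEq n] (ε : ℝ) (S : Finset (n × κ)) (k : n) :
    ℝ :=
  ε ^ 2 * (S.filter fun p => p.1 = k).card

theorem measurable_det_gramAdd_partialNoise {n κ : Type*} [Fintype n] [Fintype κ] [DecidableEq n]
    [DecidableEq κ] (A : Matrix n κ ℂ) (ε : ℝ) :
    Measurable fun y : n × κ → ℝ =>
      ENNReal.ofReal (gramAdd (partialNoise A ε ∅ y) 0).det.re := by
  refine ENNReal.measurable_ofReal.comp (Continuous.det_gramAdd_re ?_ 0).measurable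
  refine continuous_const.add (continuous_matrix fun a b => ?_)
  simp only [Finset.notMem_empty, if_false, of_apply]
  fun_prop

/-- The entries are integrated out one at a time. Each one leaves the noise and is replaced by `ε ^
2` on the diagonal of its row, so the integrand keeps its form and the induction goes on. -/
theorem lmarginal_det_gramAdd_le {n κ : Type*} [Fintype n] [Fintype κ] [DecidableEq n]
    [DecidableEq κ] (A : Matrix n κ ℂ) (ε : ℝ) (S : Finset (n × κ)) (x : n × κ → ℝ) :
    (∫⋯∫⁻_S, (fun y => ENNReal.ofReal (gramAdd (partialNoise A ε ∅ y) 0).det.re)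
        ∂fun _ => gaussianReal 0 1) x ≤
      ENNReal.ofReal (gramAdd (partialNoise A ε S x) (rowWeight ε S)).det.re := by
  induction S using Finset.induction_on generalizing x with
  | empty =>
    have : rowWeight (n := n) (κ := κ) ε ∅ = 0 := by ext; simp [rowWeight]
    simp [this]
  | insert p S hp ih =>
    rw [lmarginal_insert _ (measurable_det_gramAdd_partialNoise A ε) hp]
    refine (lintegral_mono fun t => ih _).trans ?_
    obtain ⟨i, j⟩ := p
    have hnoise : ∀ t : ℝ, partialNoise A ε S (Function.update x (i, j) t) =
        partialNoise A ε (insert (i, j) S) x + single i j ((ε * t : ℝ) : ℂ) := by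
      intro t
      ext a b
      by_cases hab : (a, b) = (i, j)
      · obtain ⟨rfl, rfl⟩ := Prod.mk.inj hab
        simp [partialNoise, hp]
      · have hne : ¬ (i = a ∧ j = b) := fun h => hab (by rw [h.1, h.2])
        simp only [partialNoise, Matrix.add_apply, of_apply, Finset.mem_insert, hab, false_or,
          Function.update_of_ne hab, single_apply, hne, if_false, add_zero]
    have hweight : rowWeight ε (insert (i, j) S) = rowWeight ε S + Pi.single i (ε ^ 2) := by
      ext k
      rcases eq_or_ne i k with rfl | hk
      · simp [rowWeight, Finset.filter_insert, hp, mul_add]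
      · simp [rowWeight, Finset.filter_insert, hk, hk.symm]
    simp only [hnoise, hweight]
    exact lintegral_det_gramAdd_single_le _
      (fun k => mul_nonneg (sq_nonneg ε) (Nat.cast_nonneg _)) i j ε

/-- The second moment of the determinant of a matrix with i.i.d. Gaussian noise. -/
theorem lintegral_normSq_det_add_gaussian_le {N : ℕ} {Ω : Type*} [MeasurableSpace Ω]
    {P : Measure Ω} [IsProbabilityMeasure P] {G : Ω → Matrix (Fin N) (Fin N) ℝ}
    (hG : IsStdGaussianMatrix P G) (A : Matrix (Fin N) (Fin N) ℂ) (ε : ℝ) :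
    ∫⁻ ω, ENNReal.ofReal (‖(A + (ε : ℂ) • (G ω).map Complex.ofReal).det‖ ^ 2) ∂P ≤
      ENNReal.ofReal (gramAdd A fun _ => N * ε ^ 2).det.re := by
  have haem : ∀ p : Fin N × Fin N, AEMeasurable (fun ω => G ω p.1 p.2) P :=
    fun p => (hG.hasLaw p.1 p.2).aemeasurable
  have hlaw : P.map (fun ω (p : Fin N × Fin N) => G ω p.1 p.2) =
      Measure.pi fun _ => gaussianReal 0 1 := by
    rw [(iIndepFun_iff_map_fun_eq_pi_map haem).1 hG.indep]
    congr 1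
    ext1 p
    exact (hG.hasLaw p.1 p.2).map_eq
  have hsq : ∀ W : Matrix (Fin N) (Fin N) ℂ, (gramAdd W 0).det.re = ‖W.det‖ ^ 2 := by
    intro W
    have : gramAdd W 0 = W * Wᴴ := by
      ext a b; simp [gramAdd]
    rw [this, det_mul, det_conjTranspose, RCLike.star_def, Complex.mul_conj, Complex.ofReal_re,
      Complex.normSq_eq_norm_sq]
  have hnoise : ∀ ω, A + (ε : ℂ) • (G ω).map Complex.ofReal =
      partialNoise A ε ∅ fun p => G ω p.1 p.2 := by
    intro ω
    ext a b
    simp [partialNoise]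
  calc ∫⁻ ω, ENNReal.ofReal (‖(A + (ε : ℂ) • (G ω).map Complex.ofReal).det‖ ^ 2) ∂P
      = ∫⁻ y, ENNReal.ofReal (gramAdd (partialNoise A ε ∅ y) 0).det.re
          ∂Measure.pi fun _ => gaussianReal 0 1 := by
        rw [← hlaw, lintegral_map' (measurable_det_gramAdd_partialNoise A ε).aemeasurable
          (aemeasurable_pi_lambda _ haem)]
        simp only [hnoise, hsq]
    _ ≤ _ := by
        rw [lintegral_eq_lmarginal_univ 0]
        refine (lmarginal_det_gramAdd_le A ε Finset.univ 0).trans (le_of_eq ?_)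
        have h1 : partialNoise A ε Finset.univ 0 = A := by ext; simp [partialNoise]
        have h2 : rowWeight (n := Fin N) (κ := Fin N) ε Finset.univ = fun _ => N * ε ^ 2 := by
          ext k
          have : (Finset.univ.filter fun p : Fin N × Fin N => p.1 = k) =
              {k} ×ˢ Finset.univ := by
            ext ⟨a, b⟩
            simp [eq_comm]
          rw [rowWeight, this]
          simp [mul_comm]
        rw [h1, h2]

end SecondMoment

/-! ### Gram determinants of Jordan blocks -/

section JordanGram

open Matrix
open scoped ComplexOrder

/-- The tridiagonal matrix `J Jᴴ + t` for a Jordan block `J` with eigenvalue `w`. -/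
noncomputable def jordanGram (d : ℕ) (w : ℂ) (t : ℝ) : Matrix (Fin d) (Fin d) ℂ :=
  Matrix.of fun i j =>
    if i = j then (if (i : ℕ) + 1 = d then ((‖w‖ ^ 2 + t : ℝ) : ℂ) else ((‖w‖ ^ 2 + 1 + t : ℝ) : ℂ))
    else if (i : ℕ) + 1 = j then star w else if (j : ℕ) + 1 = i then w else 0

theorem gramAdd_jordanBlock (d : ℕ) (w : ℂ) (t : ℝ) :
    gramAdd (jordanBlock d w) (fun _ => t) = jordanGram d w t := by
  have hJ : ∀ i k : Fin d, jordanBlock d w i k =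
      (if i = k then w else 0) + (if (i : ℕ) + 1 = k then 1 else 0) := by
    intro i k
    by_cases h : i = k
    · subst h; simp [jordanBlock]
    · simp [jordanBlock, h]
  have hsum : ∀ (i : Fin d) (f : Fin d → ℂ), ∑ k, jordanBlock d w i k * f k =
      w * f i + if h : (i : ℕ) + 1 < d then f ⟨i + 1, h⟩ else 0 := by
    intro i f
    simp only [hJ, add_mul, Finset.sum_add_distrib, ite_mul, zero_mul, one_mul, Finset.sum_ite_eq,
      Finset.mem_univ, if_true]
    congr 1
    split_ifs with h
    · rw [Finset.sum_eq_single ⟨i + 1, h⟩]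
      · simp
      · intro b _ hb
        rw [if_neg]
        intro hb'
        exact hb (Fin.ext hb'.symm)
      · simp
    · refine Finset.sum_eq_zero fun k _ => if_neg fun hk => h ?_
      rw [hk]; exact k.2
  have hw : w * star w = ((‖w‖ ^ 2 : ℝ) : ℂ) := by
    rw [RCLike.star_def, Complex.mul_conj, Complex.normSq_eq_norm_sq]
  ext i j
  rw [gramAdd, Matrix.add_apply, mul_apply]
  simp only [conjTranspose_apply]
  rw [hsum, jordanGram, of_apply, diagonal_apply]
  have hi := i.2
  have hj := j.2
  rcases lt_trichotomy (i : ℕ) j with hij | hij | hij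
  · have h1 : i ≠ j := fun h => by simp [h] at hij
    have h2 : (i : ℕ) + 1 < d := by omega
    have h3 : ¬ (j : ℕ) + 1 = i := by omega
    have h5 : ¬ (j = i) := fun h => h1 h.symm
    by_cases h6 : (i : ℕ) + 1 = j
    · have h7 : j = ⟨i + 1, h2⟩ := Fin.ext h6.symm
      rw [dif_pos h2, ← h7]
      simp [jordanBlock, h1, h5, h3, h6]
    · have h7 : ¬ j = ⟨i + 1, h2⟩ := fun h => h6 (by rw [h])
      simp [jordanBlock, h1, h2, h3, h5, h6, h7]
      omega
  · have h1 : i = j := Fin.ext hij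
    subst h1
    by_cases h2 : (i : ℕ) + 1 < d
    · have h3 : ¬ (i : ℕ) + 1 = d := by omega
      have h4 : ¬ i = ⟨i + 1, h2⟩ := fun h => by simpa using congrArg Fin.val h
      simp only [h2, dif_pos, jordanBlock, of_apply, h4, if_true, if_false, h3, hw]
      simp
    · have h3 : (i : ℕ) + 1 = d := by omega
      simp only [jordanBlock, of_apply, if_true, h3, hw]
      simp
  · have h1 : ¬ i = j := fun h => by simp [h] at hij
    have h5 : ¬ (j = i) := fun h => h1 h.symm
    have h6 : ¬ (i : ℕ) + 1 = j := by omega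
    have h8 : ¬ (j : ℕ) = i := by omega
    have h9 : ¬ (j : ℕ) = i + 1 := by omega
    by_cases h2 : (i : ℕ) + 1 < d
    · have h7 : ¬ j = ⟨i + 1, h2⟩ := fun h => h9 (by rw [h])
      simp [jordanBlock, h1, h2, h5, h6, h7, h8]
    · simp [jordanBlock, h1, h2, h5, h6]

theorem det_jordanGram_one (w : ℂ) (t : ℝ) : (jordanGram 1 w t).det = ((‖w‖ ^ 2 + t : ℝ) : ℂ) := by
  simp [jordanGram]

/-- Expansion along the first row. The exceptional diagonal entry sits in the last corner, so
deleting leading rows and columns leaves matrices of the same family. -/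
theorem det_jordanGram_add_two (d : ℕ) (w : ℂ) (t : ℝ) :
    (jordanGram (d + 2) w t).det = ((‖w‖ ^ 2 + 1 + t : ℝ) : ℂ) * (jordanGram (d + 1) w t).det -
      ((‖w‖ ^ 2 : ℝ) : ℂ) * (jordanGram d w t).det := by
  have hw : star w * w = ((‖w‖ ^ 2 : ℝ) : ℂ) := by
    rw [RCLike.star_def, mul_comm, Complex.mul_conj, Complex.normSq_eq_norm_sq]
  rw [det_succ_row_zero, Fin.sum_univ_succ, Fin.sum_univ_succ, Finset.sum_eq_zero]
  · have e1 : (jordanGram (d + 2) w t).submatrix Fin.succ (Fin.succAbove 0) =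
        jordanGram (d + 1) w t := by
      ext i j
      simp [jordanGram]
    have e2 : ((jordanGram (d + 2) w t).submatrix Fin.succ
        (Fin.succAbove (Fin.succ 0))).det = w * (jordanGram d w t).det := by
      rw [det_succ_column_zero, Fin.sum_univ_succ, Finset.sum_eq_zero]
      · have e3 : ((jordanGram (d + 2) w t).submatrix Fin.succ
            (Fin.succAbove (Fin.succ 0))).submatrix (Fin.succAbove 0) Fin.succ =
            jordanGram d w t := by
          ext i j
          simp [jordanGram]
        rw [e3]
        simp [jordanGram]
      · intro k _
        have : (jordanGram (d + 2) w t).submatrix Fin.succ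
            (Fin.succAbove (Fin.succ 0)) k.succ 0 = 0 := by
          simp [jordanGram]
        rw [this]; simp
    rw [e1, e2, ← hw]
    simp [jordanGram]
    ring
  · intro k _
    have : jordanGram (d + 2) w t 0 k.succ.succ = 0 := by
      simp [jordanGram, (Fin.succ_ne_zero k.succ).symm]
    rw [this]; simp

/-- The hypothesis gives `x - m ≤ √t * √x`. If the conclusion failed, then `√x - √m > √t * √m ≥ √t`,
and multiplying by `√x + √m` would contradict this. -/
theorem le_mul_one_add_sqrt_sq {x m t : ℝ} (hx : 0 ≤ x) (hm : 1 ≤ m) (ht : 0 ≤ t)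
    (h : (x - m) ^ 2 ≤ t * x) : x ≤ m * (1 + √t) ^ 2 := by
  have h1 : x - m ≤ √t * √x :=
    (abs_le_of_sq_le_sq' (by rw [mul_pow, Real.sq_sqrt ht, Real.sq_sqrt hx]; exact h)
      (by positivity)).2
  have hz := Real.sq_sqrt hx
  have hμ := Real.sq_sqrt (zero_le_one.trans hm)
  have hμ1 : 1 ≤ √m := Real.one_le_sqrt.2 hm
  have hle : √x ≤ √m * (1 + √t) := by
    by_contra! hlt
    have h2 : √t < √x - √m := by nlinarith [Real.sqrt_nonneg t]
    have h3 : 0 < √x + √m := by linarith [Real.sqrt_nonneg x]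
    have h4 := mul_lt_mul_of_pos_right h2 h3
    have h5 : 0 ≤ √t * √m := by positivity
    linarith
  calc x = √x ^ 2 := hz.symm
    _ ≤ (√m * (1 + √t)) ^ 2 := by gcongr
    _ = _ := by rw [mul_pow, hμ]

/-- The characteristic polynomial `X² - (s + 1 + t) X + s` takes the values `-t` at `1` and `-t s`
at `s`, so both points lie between its roots. -/
theorem exists_roots {s t : ℝ} (hs : 0 ≤ s) (ht : 0 < t) :
    ∃ x y : ℝ, x + y = s + 1 + t ∧ x * y = s ∧ 0 ≤ y ∧ y < 1 ∧ y ≤ s ∧ 1 < x ∧ s < x := by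
  set r := √((s + 1 + t) ^ 2 - 4 * s) with hr
  have hdisc : 0 < (s + 1 + t) ^ 2 - 4 * s := by nlinarith [sq_nonneg (s - 1)]
  have hr0 : 0 < r := Real.sqrt_pos.2 hdisc
  have hr2 : r ^ 2 = (s + 1 + t) ^ 2 - 4 * s := Real.sq_sqrt hdisc.le
  set x := (s + 1 + t + r) / 2 with hx
  set y := (s + 1 + t - r) / 2 with hy
  have hsum : x + y = s + 1 + t := by rw [hx, hy]; ring
  have hprod : x * y = s := by rw [hx, hy]; nlinarith
  have hyx : y < x := by rw [hx, hy]; linarith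
  have hpos : 0 < x := by rw [hx]; positivity
  clear_value x y
  have hy0 : 0 ≤ y := by
    by_contra! h
    nlinarith
  have hy1 : (x - 1) * (1 - y) = t := by linear_combination hsum - hprod
  have hys : (x - s) * (s - y) = t * s := by linear_combination s * hsum - hprod
  have hx1 : 1 < x := by
    by_contra! h
    nlinarith
  have hxs : s < x := by
    by_contra! h
    nlinarith
  refine ⟨x, y, hsum, hprod, hy0, ?_, ?_, hx1, hxs⟩
  · by_contra! h
    nlinarith
  · by_contra! h
    nlinarith [mul_nonneg ht.le hs]

/-- The solution is `θ x ^ d + (1 - θ) y ^ d` with `0 ≤ θ ≤ 1`, and `x` is at most `max 1 s` up to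
the factor `(1 + √t) ^ 2`. For `s ≥ q`, `max 1 s ≤ s / q`, so `x ^ d` is comparable to `s ^ d`. For
`s < q` the root `x` is close to `1`, but its weight `θ` is of order `t`, while `y ≤ s`. -/
theorem linear_recurrence_le {u : ℕ → ℝ} {s t q : ℝ} (hs : 0 ≤ s) (ht : 0 < t) (ht1 : t ≤ 1)
    (hq0 : 0 < q) (hq1 : q < 1) (h0 : u 0 = 1) (h1 : u 1 = s + t)
    (hu : ∀ d, u (d + 2) = (s + 1 + t) * u (d + 1) - s * u d) (d : ℕ) :
    u d ≤ (4 / (1 - q) ^ 2 + 1) * ((1 + √t) ^ 2 / q) ^ d * max (s ^ d) t := by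
  obtain ⟨x, y, hsum, hprod, hy0, hy1', hys', hx1, hxs⟩ := exists_roots hs ht
  have hpos : 0 < x := by linarith
  have hyx : y < x := by linarith
  have hpx : (x - 1) * (x - s) = t * x := by linear_combination x * hsum - hprod
  set θ := (x - 1) / (x - y) with hθ
  have hθ0 : 0 ≤ θ := div_nonneg (by linarith) (by linarith)
  have hθ1 : θ ≤ 1 := (div_le_one (by linarith)).2 (by linarith)
  have hθ2 : θ * (x - y) = x - 1 := div_mul_cancel₀ _ (by linarith)
  have hclosed : ∀ d, u d = θ * x ^ d + (1 - θ) * y ^ d ∧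
      u (d + 1) = θ * x ^ (d + 1) + (1 - θ) * y ^ (d + 1) := by
    intro d
    induction d with
    | zero =>
      refine ⟨by simp [h0], ?_⟩
      rw [h1]
      linear_combination - hsum - hθ2
    | succ d ih =>
      refine ⟨ih.2, ?_⟩
      rw [hu, ih.1, ih.2, ← hsum, ← hprod]
      ring
  have hst0 : 0 ≤ √t := Real.sqrt_nonneg t
  have hst1 : √t ≤ 1 := Real.sqrt_le_one.2 ht1
  have hst2 : √t ^ 2 = t := Real.sq_sqrt ht.le
  have hxm : x ≤ max 1 s * (1 + √t) ^ 2 := by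
    have hm1 : 1 ≤ max 1 s := le_max_left _ _
    have hm : (x - max 1 s) ^ 2 ≤ t * x := by
      rw [← hpx]
      rcases max_cases 1 s with ⟨h, h'⟩ | ⟨h, h'⟩ <;> rw [h] <;> nlinarith
    exact le_mul_one_add_sqrt_sq hpos.le hm1 ht.le hm
  have hC : 0 ≤ 4 / (1 - q) ^ 2 := by positivity
  have hb : 1 ≤ (1 + √t) ^ 2 := by nlinarith
  have hb' : (1 + √t) ^ 2 ≤ (1 + √t) ^ 2 / q := by
    rw [le_div_iff₀ hq0]; nlinarith
  have hmax : 0 ≤ max (s ^ d) t := le_max_of_le_right ht.le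
  rw [(hclosed d).1]
  rcases le_or_gt q s with hqs | hqs
  · have hms : max 1 s ≤ s / q := by
      refine max_le ?_ ?_
      · rw [le_div_iff₀ hq0]; linarith
      · rw [le_div_iff₀ hq0]; nlinarith
    calc θ * x ^ d + (1 - θ) * y ^ d ≤ θ * x ^ d + (1 - θ) * x ^ d := by
          have : 0 ≤ 1 - θ := by linarith
          gcongr
      _ = x ^ d := by ring
      _ ≤ (s / q * (1 + √t) ^ 2) ^ d := by
          refine pow_le_pow_left₀ hpos.le (hxm.trans ?_) d
          gcongr
      _ = 1 * ((1 + √t) ^ 2 / q) ^ d * s ^ d := by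
          rw [one_mul, ← mul_pow]; congr 1; ring
      _ ≤ _ := by
          gcongr
          · linarith
          · exact le_max_left _ _
  · have hx4 : x ≤ (1 + √t) ^ 2 := by
      simpa [max_eq_left (hqs.le.trans hq1.le)] using hxm
    -- Since `θ (x - y) = x - 1` and `(x - 1)(x - s) = t x`, the weight is `t x / ((x - s)(x - y))`.
    -- Both differences exceed `1 - q`, and `x ≤ 4` because `t ≤ 1`.
    have hθt : θ ≤ 4 / (1 - q) ^ 2 * t := by
      rw [div_mul_eq_mul_div, le_div_iff₀ (by nlinarith)]
      have h5 : 1 - q ≤ x - s := by linarith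
      have h6 : 1 - q ≤ x - y := by linarith
      have h7 : (1 - q) ^ 2 ≤ (x - s) * (x - y) := by nlinarith
      calc θ * (1 - q) ^ 2 ≤ θ * ((x - s) * (x - y)) := by gcongr
        _ = t * x := by rw [← hpx, ← hθ2]; ring
        _ ≤ t * 4 := by
          gcongr
          nlinarith
        _ = 4 * t := by ring
    calc θ * x ^ d + (1 - θ) * y ^ d
        ≤ 4 / (1 - q) ^ 2 * t * ((1 + √t) ^ 2 / q) ^ d + 1 * s ^ d := by
          have : x ≤ (1 + √t) ^ 2 / q := hx4.trans hb'
          have : 1 - θ ≤ 1 := by linarith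
          gcongr
      _ ≤ 4 / (1 - q) ^ 2 * max (s ^ d) t * ((1 + √t) ^ 2 / q) ^ d +
          ((1 + √t) ^ 2 / q) ^ d * max (s ^ d) t := by
          have : 1 ≤ ((1 + √t) ^ 2 / q) ^ d := one_le_pow₀ (hb.trans hb')
          gcongr
          · exact le_max_right _ _
          · exact le_max_left _ _
      _ = _ := by ring

theorem det_jordanGram_im (d : ℕ) (w : ℂ) {t : ℝ} (ht : 0 ≤ t) : (jordanGram d w t).det.im = 0 := by
  rw [← gramAdd_jordanBlock]
  exact (Complex.nonneg_iff.1 (gramAdd_posSemidef _ fun _ => ht).det_nonneg).2.symm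

theorem det_jordanGram_re_nonneg (d : ℕ) (w : ℂ) {t : ℝ} (ht : 0 ≤ t) :
    0 ≤ (jordanGram d w t).det.re := by
  rw [← gramAdd_jordanBlock]
  exact det_gramAdd_re_nonneg _ fun _ => ht

theorem det_jordanGram_re_le {t q : ℝ} (ht : 0 < t) (ht1 : t ≤ 1) (hq0 : 0 < q) (hq1 : q < 1)
    (d : ℕ) (w : ℂ) :
    (jordanGram d w t).det.re ≤
      (4 / (1 - q) ^ 2 + 1) * ((1 + √t) ^ 2 / q) ^ d * max ((‖w‖ ^ 2) ^ d) t := by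
  refine linear_recurrence_le (u := fun d => (jordanGram d w t).det.re) (sq_nonneg _) ht ht1 hq0
    hq1 (by simp) ?_ (fun d => ?_) d
  · rw [det_jordanGram_one, Complex.ofReal_re]
  · rw [det_jordanGram_add_two, Complex.sub_re, Complex.re_ofReal_mul, Complex.re_ofReal_mul]

theorem det_blockDiagonal_sigma {o R : Type*} [CommRing R] [Fintype o] [LinearOrder o]
    {m : o → Type*} [∀ i, Fintype (m i)] [∀ i, DecidableEq (m i)] (M : ∀ i, Matrix (m i) (m i) R) :
    (blockDiagonal' M).det = ∏ i, (M i).det := by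
  rw [(blockTriangular_blockDiagonal' M).det_fintype]
  refine Finset.prod_congr rfl fun i _ => ?_
  let f : m i → {a : Σ i, m i // a.1 = i} := fun k => ⟨⟨i, k⟩, rfl⟩
  have hf : Function.Bijective f := by
    refine ⟨fun k l h => ?_, ?_⟩
    · simpa [f] using h
    · rintro ⟨⟨j, k⟩, rfl⟩
      exact ⟨k, rfl⟩
  rw [← det_submatrix_equiv_self (Equiv.ofBijective f hf)]
  congr 1
  ext k l
  simp [f, toSquareBlock_def]

/-- The matrix of `B` shifted by a scalar is block diagonal with the shifted Jordan blocks. -/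
theorem JordanData.matrix_sub_scalar {N : ℕ} (B : JordanData N) (z : ℂ) :
    B.matrix - Matrix.scalar (Fin N) z = Matrix.reindex B.index B.index
      (Matrix.blockDiagonal' fun i => jordanBlock (B.dim i) (B.eig i - z)) := by
  have h : (Matrix.blockDiagonal' fun i => jordanBlock (B.dim i) (B.eig i - z)) =
      (Matrix.blockDiagonal' fun i => jordanBlock (B.dim i) (B.eig i)) -
        Matrix.scalar _ z := by
    ext ⟨i, k⟩ ⟨j, l⟩
    by_cases hij : i = j
    · subst hij
      by_cases hkl : k = l
      · subst hkl
        simp [blockDiagonal'_apply, jordanBlock]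
      · simp [blockDiagonal'_apply, jordanBlock, hkl]
    · simp [blockDiagonal'_apply, hij]
  rw [h]
  ext a b
  simp [JordanData.matrix, diagonal_apply]

theorem JordanData.det_gramAdd_matrix {N : ℕ} (B : JordanData N) (z : ℂ) (t : ℝ) :
    (gramAdd (B.matrix - Matrix.scalar (Fin N) z) fun _ => t).det =
      ∏ i, (jordanGram (B.dim i) (B.eig i - z) t).det := by
  rw [← det_blockDiagonal_sigma]
  simp only [← gramAdd_jordanBlock]
  rw [B.matrix_sub_scalar, ← det_reindex_self B.index]
  congr 1
  have h1 : (blockDiagonal' fun i => gramAdd (jordanBlock (B.dim i) (B.eig i - z)) fun _ => t) =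
      gramAdd (blockDiagonal' fun i => jordanBlock (B.dim i) (B.eig i - z)) fun _ => t := by
    have h2 : (diagonal fun _ : Σ i, Fin (B.dim i) => (t : ℂ)) =
        blockDiagonal' fun i => diagonal fun _ : Fin (B.dim i) => (t : ℂ) :=
      (blockDiagonal'_diagonal fun (i : Fin B.ℓ) (_ : Fin (B.dim i)) => (t : ℂ)).symm
    unfold gramAdd
    rw [blockDiagonal'_conjTranspose, ← blockDiagonal'_mul, h2, ← blockDiagonal'_add]
    rfl
  rw [h1]
  ext a b
  simp [gramAdd, mul_apply, diagonal_apply]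

/-- The constant is paid once per block and the exponential factor once per dimension, so few blocks
make the first harmless. -/
theorem JordanData.det_gramAdd_matrix_re_le {N : ℕ} (B : JordanData N) (z : ℂ) {t q : ℝ}
    (ht : 0 < t) (ht1 : t ≤ 1) (hq0 : 0 < q) (hq1 : q < 1) :
    (gramAdd (B.matrix - Matrix.scalar (Fin N) z) fun _ => t).det.re ≤
      (4 / (1 - q) ^ 2 + 1) ^ B.ℓ * ((1 + √t) ^ 2 / q) ^ N *
        ∏ i, max ((‖B.eig i - z‖ ^ 2) ^ B.dim i) t := by
  have hre : (∏ i, (jordanGram (B.dim i) (B.eig i - z) t).det).re =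
      ∏ i, (jordanGram (B.dim i) (B.eig i - z) t).det.re := by
    have : ∀ i, (jordanGram (B.dim i) (B.eig i - z) t).det =
        (((jordanGram (B.dim i) (B.eig i - z) t).det.re : ℝ) : ℂ) := fun i =>
      Complex.ext rfl (by simp [det_jordanGram_im _ _ ht.le])
    rw [Finset.prod_congr rfl fun i _ => this i, ← Complex.ofReal_prod, Complex.ofReal_re]
  rw [B.det_gramAdd_matrix, hre]
  refine (Finset.prod_le_prod (fun i _ => det_jordanGram_re_nonneg _ _ ht.le)
    fun i _ => det_jordanGram_re_le ht ht1 hq0 hq1 _ _).trans (le_of_eq ?_)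
  rw [Finset.prod_mul_distrib, Finset.prod_mul_distrib, Finset.prod_const, Finset.prod_pow_eq_pow_sum,
    B.sum_dim]
  simp

end JordanGram

/-! ### Logarithmic potentials of spectra and circles -/

section LogPotential

theorem ENNReal_log_enorm {w : ℂ} (hw : w ≠ 0) : ENNReal.log ‖w‖ₑ = (Real.log ‖w‖ : EReal) := by
  rw [← ofReal_norm, ENNReal.log_ofReal_of_pos (norm_pos_iff.2 hw)]

theorem logPotential_eq_integral {ρ : Measure ℂ} {z : ℂ} (h0 : ρ {z} = 0)
    (hint : Integrable (fun x => Real.log ‖z - x‖) ρ) :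
    logPotential ρ z = ((∫ x, Real.log ‖z - x‖ ∂ρ : ℝ) : EReal) := by
  have hae : ∀ᵐ x ∂ρ, ENNReal.log ‖z - x‖ₑ = (Real.log ‖z - x‖ : EReal) := by
    have : ∀ᵐ x ∂ρ, x ≠ z := by simpa [ae_iff] using h0
    filter_upwards [this] with x hx
    exact ENNReal_log_enorm (sub_ne_zero.2 hx.symm)
  have hpos : ∫⁻ x, (ENNReal.log ‖z - x‖ₑ).toENNReal ∂ρ =
      ∫⁻ x, ENNReal.ofReal (Real.log ‖z - x‖) ∂ρ := by
    refine lintegral_congr_ae ?_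
    filter_upwards [hae] with x hx
    rw [hx, EReal.real_coe_toENNReal]
  have hneg : ∫⁻ x, (-ENNReal.log ‖z - x‖ₑ).toENNReal ∂ρ =
      ∫⁻ x, ENNReal.ofReal (-Real.log ‖z - x‖) ∂ρ := by
    refine lintegral_congr_ae ?_
    filter_upwards [hae] with x hx
    rw [hx, ← EReal.coe_neg, EReal.real_coe_toENNReal]
  rw [logPotential, hpos, hneg, integral_eq_lintegral_pos_part_sub_lintegral_neg_part hint,
    EReal.coe_sub, EReal.coe_ennreal_toReal, EReal.coe_ennreal_toReal]
  · exact hint.neg.lintegral_lt_top.ne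
  · exact hint.lintegral_lt_top.ne

theorem lintegral_multiset_sum_dirac (s : Multiset ℂ) (f : ℂ → ℝ≥0∞) :
    ∫⁻ x, f x ∂(s.map fun x => Measure.dirac x).sum = (s.map f).sum := by
  induction s using Multiset.induction_on with
  | empty => simp
  | cons a s ih => simp [lintegral_add_measure, ih]

theorem integral_multiset_sum_dirac (s : Multiset ℂ) (f : ℂ → ℝ) :
    Integrable f (s.map fun x => Measure.dirac x).sum ∧
      ∫ x, f x ∂(s.map fun x => Measure.dirac x).sum = (s.map f).sum := by
  induction s using Multiset.induction_on with
  | empty => simp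
  | cons a s ih =>
    have ha : Integrable f (Measure.dirac a) := integrable_dirac (by simp)
    simp only [Multiset.map_cons, Multiset.sum_cons]
    refine ⟨ha.add_measure ih.1, ?_⟩
    rw [integral_add_measure ha ih.1, ih.2, integral_dirac]

theorem exp_le_norm_det_of_le_logPotential {N : ℕ} (hN : 0 < N) (A : Matrix (Fin N) (Fin N) ℂ)
    (z : ℂ) {u : ℝ} (hu : (u : EReal) ≤ logPotential (empiricalSpectralMeasure A) z) :
    Real.exp (N * u) ≤ ‖(A - Matrix.scalar (Fin N) z).det‖ := by
  have hdet : ‖(A - Matrix.scalar (Fin N) z).det‖ =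
      ((A.charpoly.roots.map fun x => ‖z - x‖)).prod := by
    rw [← neg_sub, Matrix.det_neg, ← Matrix.eval_charpoly,
      (IsAlgClosed.splits A.charpoly).eval_eq_prod_roots_of_monic A.charpoly_monic]
    rw [norm_mul, norm_pow, norm_neg, norm_one, one_pow, one_mul]
    generalize A.charpoly.roots = s
    induction s using Multiset.induction_on with
    | empty => simp
    | cons a s ih => simp [ih]
  have hN0 : (N : ℝ≥0∞) ≠ 0 := by exact_mod_cast hN.ne'
  by_cases hz : z ∈ A.charpoly.roots
  -- At an eigenvalue the negative part has infinite integral, and subtracting `⊤` in `EReal` gives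
  -- `⊥`, which no real number bounds from below.
  · exfalso
    have hbot : logPotential (empiricalSpectralMeasure A) z = ⊥ := by
      obtain ⟨s, hs⟩ := Multiset.exists_cons_of_mem hz
      have hneg : ∫⁻ x, (-ENNReal.log ‖z - x‖ₑ).toENNReal ∂(empiricalSpectralMeasure A) = ⊤ := by
        rw [empiricalSpectralMeasure, lintegral_smul_measure, lintegral_multiset_sum_dirac, hs]
        simp [ENNReal.mul_top]
      rw [logPotential, hneg]
      simp
    rw [hbot] at hu
    simp at hu
  · have hi := integral_multiset_sum_dirac A.charpoly.roots fun x => Real.log ‖z - x‖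
    rw [logPotential_eq_integral, empiricalSpectralMeasure, integral_smul_measure, hi.2,
      EReal.coe_le_coe_iff] at hu
    · have hlog : ∀ s : Multiset ℂ, z ∉ s → 0 < (s.map fun x => ‖z - x‖).prod ∧
          (s.map fun x => Real.log ‖z - x‖).sum = Real.log (s.map fun x => ‖z - x‖).prod := by
        intro s hs
        induction s using Multiset.induction_on with
        | empty => simp
        | cons a s ih =>
          have hs' : z ≠ a ∧ z ∉ s := by simpa using hs
          have hza : 0 < ‖z - a‖ := norm_pos_iff.2 (sub_ne_zero.2 hs'.1)
          simp only [Multiset.map_cons, Multiset.sum_cons, Multiset.prod_cons]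
          refine ⟨mul_pos hza (ih hs'.2).1, ?_⟩
          rw [Real.log_mul hza.ne' (ih hs'.2).1.ne', (ih hs'.2).2]
      rw [hdet, ← Real.le_log_iff_exp_le (hlog _ hz).1, ← (hlog _ hz).2]
      have hN' : (0 : ℝ) < N := by exact_mod_cast hN
      simp only [ENNReal.toReal_inv, ENNReal.toReal_natCast, smul_eq_mul] at hu
      rw [mul_comm, ← le_div_iff₀ hN', div_eq_inv_mul]
      exact hu
    · rw [empiricalSpectralMeasure, Measure.smul_apply, smul_eq_mul]
      have : (A.charpoly.roots.map fun x => Measure.dirac x).sum {z} = 0 := by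
        rw [← lintegral_indicator_one (measurableSet_singleton z), lintegral_multiset_sum_dirac]
        refine Multiset.sum_eq_zero fun y hy => ?_
        obtain ⟨x, hx, rfl⟩ := Multiset.mem_map.1 hy
        have : x ≠ z := fun h => hz (h ▸ hx)
        simp [this]
      simp [this]
    · exact hi.1.smul_measure (by simp [hN.ne'])

theorem uniformCircle_singleton {c z : ℂ} {r : ℝ} (hr : r ≠ 0) : uniformCircle c r {z} = 0 := by
  have hc := (Set.countable_singleton z).preimage_circleMap c hr
  rw [uniformCircle, Measure.map_apply (by fun_prop) (measurableSet_singleton z),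
    Measure.smul_apply, hc.measure_zero, smul_zero]

theorem measurable_log_norm_sub (z : ℂ) : Measurable fun x : ℂ => Real.log ‖z - x‖ :=
  Real.measurable_log.comp (by fun_prop)

theorem integrable_log_uniformCircle (c z : ℂ) (r : ℝ) :
    Integrable (fun x => Real.log ‖z - x‖) (uniformCircle c r) := by
  have h := circleIntegrable_log_norm_sub_const (a := z) (c := c) r
  rw [CircleIntegrable, intervalIntegrable_iff_integrableOn_Ioc_of_le Real.two_pi_pos.le] at h
  rw [uniformCircle, integrable_map_measure
    (measurable_log_norm_sub z).aestronglyMeasurable (by fun_prop)]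
  refine Integrable.smul_measure ?_ (by simp [Real.pi_pos])
  refine h.congr (ae_of_all _ fun θ => ?_)
  simp [norm_sub_rev]

/-- Jensen's formula: the potential of a circle is constant inside it and that of a point mass at
the center outside. -/
theorem integral_log_uniformCircle (c z : ℂ) {r : ℝ} (hr : 0 < r) :
    ∫ x, Real.log ‖z - x‖ ∂uniformCircle c r = Real.log (max ‖c - z‖ r) := by
  have h := circleAverage_log_norm_sub_const_eq_log_radius_add_posLog (a := z) (c := c) hr.ne'
  rw [Real.circleAverage, intervalIntegral.integral_of_le Real.two_pi_pos.le] at h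
  rw [uniformCircle, integral_map (by fun_prop)
    (measurable_log_norm_sub z).aestronglyMeasurable, integral_smul_measure,
    ENNReal.toReal_inv, ENNReal.toReal_ofReal Real.two_pi_pos.le]
  simp only [norm_sub_rev z]
  rw [h]
  rcases le_total ‖c - z‖ r with hle | hle
  · rw [max_eq_right hle, add_eq_left, Real.posLog_eq_zero_iff, abs_of_nonneg (by positivity),
      inv_mul_le_one₀ hr]
    exact hle
  · have hc : 0 < ‖c - z‖ := hr.trans_le hle
    rw [max_eq_left hle, Real.posLog_eq_log, Real.log_mul (by positivity) hc.ne', Real.log_inv]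
    · ring
    · rw [abs_of_nonneg (by positivity), ← div_eq_inv_mul, one_le_div hr]
      exact hle

theorem JordanData.logPotential_circleMeasure {N : ℕ} (hN : 0 < N) (B : JordanData N) (γ : ℝ)
    (z : ℂ) : logPotential (B.circleMeasure γ) z =
      ((∑ i, (B.dim i : ℝ) / N * Real.log (max ‖B.eig i - z‖ (B.radius γ i)) : ℝ) : EReal) := by
  have hw : ∀ i, (B.dim i : ℝ≥0∞) / (N : ℝ≥0∞) ≠ ⊤ := fun i =>
    ENNReal.div_ne_top (by simp) (by exact_mod_cast hN.ne')
  have hr : ∀ i, 0 < B.radius γ i := fun i => Real.exp_pos _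
  have hint : ∀ i ∈ Finset.univ, Integrable (fun x => Real.log ‖z - x‖)
      (((B.dim i : ℝ≥0∞) / (N : ℝ≥0∞)) • uniformCircle (B.eig i) (B.radius γ i)) := fun i _ =>
    (integrable_log_uniformCircle _ _ _).smul_measure (hw i)
  rw [logPotential_eq_integral]
  · rw [JordanData.circleMeasure, integral_finsetSum_measure hint]
    congr 1
    refine Finset.sum_congr rfl fun i _ => ?_
    rw [integral_smul_measure, integral_log_uniformCircle _ _ (hr i)]
    simp
  · rw [JordanData.circleMeasure, Measure.finsetSum_apply]
    refine Finset.sum_eq_zero fun i _ => ?_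
    rw [Measure.smul_apply, uniformCircle_singleton (hr i).ne', smul_zero]
  · exact integrable_finsetSum_measure.2 hint

/-- This explains the choice of radius: `s ^ d` and `t` in the determinant bound balance exactly
when `|c - z| = r`. -/
theorem JordanData.radius_pow {N : ℕ} (hN : 1 < N) (B : JordanData N) (γ : ℝ) (i : Fin B.ℓ) :
    (B.radius γ i ^ 2) ^ B.dim i = (N : ℝ) ^ (1 - 2 * γ) := by
  have hlog : 0 < Real.log N := Real.log_pos (by exact_mod_cast hN)
  have hd : (0 : ℝ) < B.dim i := by exact_mod_cast B.dim_pos i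
  rw [← pow_mul, JordanData.radius, ← Real.exp_nat_mul,
    Real.rpow_def_of_pos (by exact_mod_cast (zero_lt_one.trans hN)), JordanData.a]
  congr 1
  push_cast
  field_simp
  ring

theorem JordanData.exp_potential {N : ℕ} (hN : 1 < N) (B : JordanData N) (γ : ℝ) (z : ℂ) :
    Real.exp (2 * N *
        ∑ i, (B.dim i : ℝ) / N * Real.log (max ‖B.eig i - z‖ (B.radius γ i))) =
      ∏ i, max ((‖B.eig i - z‖ ^ 2) ^ B.dim i) ((N : ℝ) ^ (1 - 2 * γ)) := by
  have hN' : (N : ℝ) ≠ 0 := by exact_mod_cast (zero_lt_one.trans hN).ne'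
  rw [Finset.mul_sum, Real.exp_sum]
  refine Finset.prod_congr rfl fun i _ => ?_
  have hr : 0 < B.radius γ i := Real.exp_pos _
  have hm : 0 < max ‖B.eig i - z‖ (B.radius γ i) := lt_max_of_lt_right hr
  rw [← B.radius_pow hN γ i, ← pow_mul, ← pow_mul,
    ← (pow_left_monotoneOn (M₀ := ℝ) (n := 2 * B.dim i)).map_max (norm_nonneg _) hr.le]
  rw [show 2 * (N : ℝ) * ((B.dim i : ℝ) / N * Real.log (max ‖B.eig i - z‖ (B.radius γ i))) =
    ((2 * B.dim i : ℕ) : ℝ) * Real.log (max ‖B.eig i - z‖ (B.radius γ i)) by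
      push_cast; field_simp]
  rw [Real.exp_nat_mul, Real.exp_log hm]

end LogPotential

/-! ### Markov's inequality and the limit -/

theorem IsStdGaussianMatrix.aemeasurable_norm_det_sq {N : ℕ} {Ω : Type*} [MeasurableSpace Ω]
    {P : Measure Ω} {G : Ω → Matrix (Fin N) (Fin N) ℝ} (hG : IsStdGaussianMatrix P G)
    (A : Matrix (Fin N) (Fin N) ℂ) (ε : ℝ) :
    AEMeasurable (fun ω =>
      ENNReal.ofReal (‖(A + (ε : ℂ) • (G ω).map Complex.ofReal).det‖ ^ 2)) P := by
  have haem : AEMeasurable (fun ω (p : Fin N × Fin N) => G ω p.1 p.2) P :=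
    aemeasurable_pi_lambda _ fun p => (hG.hasLaw p.1 p.2).aemeasurable
  have hcont : Continuous fun y : Fin N × Fin N → ℝ =>
      ‖(Matrix.of fun i j => A i j + (ε : ℂ) * (y (i, j) : ℂ)).det‖ ^ 2 := by
    refine (Continuous.norm (Continuous.matrix_det (continuous_matrix fun i j => ?_))).pow 2
    simp only [Matrix.of_apply]
    fun_prop
  have heq : ∀ ω, A + (ε : ℂ) • (G ω).map Complex.ofReal =
      Matrix.of fun i j => A i j + (ε : ℂ) * (G ω i j : ℂ) := fun ω => by
    ext i j
    simp
  simp only [heq]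
  have hm : Measurable fun y : Fin N × Fin N → ℝ =>
      ENNReal.ofReal (‖(Matrix.of fun i j => A i j + (ε : ℂ) * (y (i, j) : ℂ)).det‖ ^ 2) :=
    ENNReal.measurable_ofReal.comp hcont.measurable
  have h := hm.comp_aemeasurable haem
  simpa only [Function.comp_def] using h

/-- The probability of a large potential, for fixed `N`, by Markov's inequality for the squared
determinant. -/
theorem JordanData.measure_logPotential_ge_le {N : ℕ} (hN : 1 < N) (B : JordanData N) {γ : ℝ}
    (hγ : 1 / 2 < γ) {Ω : Type*} [MeasurableSpace Ω] {P : Measure Ω} [IsProbabilityMeasure P]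
    {G : Ω → Matrix (Fin N) (Fin N) ℝ} (hG : IsStdGaussianMatrix P G) (z : ℂ) (δ : ℝ)
    {q : ℝ} (hq0 : 0 < q) (hq1 : q < 1) :
    P {ω | logPotential (B.circleMeasure γ) z + (δ : EReal) ≤
        logPotential (empiricalSpectralMeasure (B.noisy γ (G ω))) z} ≤
      ENNReal.ofReal (Real.exp (-(2 * N * δ)) * ((4 / (1 - q) ^ 2 + 1) ^ B.ℓ *
        ((1 + √((N : ℝ) ^ (1 - 2 * γ))) ^ 2 / q) ^ N)) := by
  have hN0 : 0 < N := zero_lt_one.trans hN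
  have hNr : (1 : ℝ) < N := by exact_mod_cast hN
  set t := (N : ℝ) ^ (1 - 2 * γ) with ht
  have ht0 : 0 < t := Real.rpow_pos_of_pos (by linarith) _
  have ht1 : t ≤ 1 := Real.rpow_le_one_of_one_le_of_nonpos hNr.le (by linarith)
  set ε := (N : ℝ) ^ (-γ) with hε
  have hεt : N * ε ^ 2 = t := by
    rw [hε, ht, ← Real.rpow_natCast, ← Real.rpow_mul (by linarith), sub_eq_add_neg,
      Real.rpow_add (by linarith), Real.rpow_one]
    congr 2
    push_cast
    ring
  set u := ∑ i, (B.dim i : ℝ) / N * Real.log (max ‖B.eig i - z‖ (B.radius γ i)) with hu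
  set A := B.matrix - Matrix.scalar (Fin N) z with hA
  set K := Real.exp (2 * N * (u + δ)) with hK
  have hsub : {ω | logPotential (B.circleMeasure γ) z + (δ : EReal) ≤
        logPotential (empiricalSpectralMeasure (B.noisy γ (G ω))) z} ⊆
      {ω | ENNReal.ofReal K ≤
        ENNReal.ofReal (‖(A + (ε : ℂ) • (G ω).map Complex.ofReal).det‖ ^ 2)} := by
    intro ω hω
    rw [Set.mem_ofPred_eq, B.logPotential_circleMeasure hN0, ← EReal.coe_add] at hω
    have h := exp_le_norm_det_of_le_logPotential hN0 _ z hω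
    have hnoisy : B.noisy γ (G ω) - Matrix.scalar (Fin N) z =
        A + (ε : ℂ) • (G ω).map Complex.ofReal := by
      rw [JordanData.noisy, hA]
      abel
    rw [hnoisy] at h
    refine ENNReal.ofReal_le_ofReal ?_
    calc K = Real.exp (N * (u + δ)) ^ 2 := by
          rw [hK, ← Real.exp_nat_mul]
          congr 1
          push_cast
          ring
      _ ≤ _ := by gcongr
  have hmeas : AEMeasurable (fun ω =>
      ENNReal.ofReal (‖(A + (ε : ℂ) • (G ω).map Complex.ofReal).det‖ ^ 2)) P :=
    hG.aemeasurable_norm_det_sq A ε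
  have hK0 : ENNReal.ofReal K ≠ 0 := by simp [hK, Real.exp_pos]
  have hprod := B.exp_potential hN γ z
  rw [← hu, ← ht] at hprod
  calc P {ω | logPotential (B.circleMeasure γ) z + (δ : EReal) ≤
        logPotential (empiricalSpectralMeasure (B.noisy γ (G ω))) z}
      ≤ _ := measure_mono hsub
    _ ≤ (∫⁻ ω, ENNReal.ofReal (‖(A + (ε : ℂ) • (G ω).map Complex.ofReal).det‖ ^ 2) ∂P) /
          ENNReal.ofReal K := meas_ge_le_lintegral_div hmeas hK0 ENNReal.ofReal_ne_top
    _ ≤ ENNReal.ofReal ((4 / (1 - q) ^ 2 + 1) ^ B.ℓ * ((1 + √t) ^ 2 / q) ^ N *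
          Real.exp (2 * N * u)) / ENNReal.ofReal K := by
        gcongr
        refine (lintegral_normSq_det_add_gaussian_le hG A ε).trans (ENNReal.ofReal_le_ofReal ?_)
        rw [hεt, hprod]
        exact B.det_gramAdd_matrix_re_le z ht0 ht1 hq0 hq1
    _ = _ := by
        rw [← ENNReal.ofReal_div_of_pos (Real.exp_pos _)]
        congr 1
        rw [div_eq_mul_inv, ← Real.exp_neg, mul_assoc, ← Real.exp_add, mul_comm]
        congr 2
        ring

theorem tendsto_natCast_rpow_one_sub {γ : ℝ} (hγ : 1 / 2 < γ) :
    Tendsto (fun N : ℕ => √((N : ℝ) ^ (1 - 2 * γ))) atTop (𝓝 0) := by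
  have h := (tendsto_rpow_neg_atTop (y := 2 * γ - 1) (by linarith)).comp
    tendsto_natCast_atTop_atTop
  have h2 := (Real.continuous_sqrt.tendsto 0).comp h
  simpa [Function.comp_def] using h2

theorem proposition3p1 (γ : ℝ) (hγ : 1 / 2 < γ) (B : ∀ N : ℕ, JordanData N)
    (hℓ : (fun N : ℕ => ((B N).ℓ : ℝ)) =o[atTop] fun N : ℕ => (N : ℝ))
    {Ω : ℕ → Type*} [∀ N, MeasurableSpace (Ω N)] (P : ∀ N, Measure (Ω N))
    [∀ N, IsProbabilityMeasure (P N)]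
    (G : ∀ N, Ω N → Matrix (Fin N) (Fin N) ℝ) (hG : ∀ N, IsStdGaussianMatrix (P N) (G N))
    (z : ℂ) (δ : ℝ) (hδ : 0 < δ) :
    Tendsto
      (fun N => P N {ω | logPotential ((B N).circleMeasure γ) z + (δ : EReal) ≤
        logPotential (empiricalSpectralMeasure ((B N).noisy γ (G N ω))) z})
      atTop (𝓝 0) := by
  -- The exponent per dimension is budgeted against `2δ`: `δ / 2` for `1 / q`, `δ / 2` for `(1 + √t)
  -- ^ 2`, `δ / 2` for `C ^ ℓ`. A decay rate of `δ / 2` is left.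
  set q := Real.exp (-(δ / 2)) with hq
  have hq0 : 0 < q := Real.exp_pos _
  have hq1 : q < 1 := by
    rw [hq, ← Real.exp_zero]
    exact Real.exp_lt_exp.2 (by linarith)
  set C := 4 / (1 - q) ^ 2 + 1 with hC
  have hC1 : 1 ≤ C := by
    have : 0 ≤ 4 / (1 - q) ^ 2 := by positivity
    linarith
  have hlogC : 0 ≤ Real.log C := Real.log_nonneg hC1
  have hlim : Tendsto (fun N : ℕ => ENNReal.ofReal (Real.exp (-(δ / 2 * N)))) atTop (𝓝 0) := by
    have h : Tendsto (fun N : ℕ => Real.exp (-(δ / 2 * N))) atTop (𝓝 0) :=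
      Real.tendsto_exp_neg_atTop_nhds_zero.comp
        (tendsto_natCast_atTop_atTop.const_mul_atTop (by linarith))
    simpa using ENNReal.tendsto_ofReal h
  refine tendsto_of_tendsto_of_tendsto_of_le_of_le' tendsto_const_nhds hlim
    (Eventually.of_forall fun _ => zero_le) ?_
  -- The `+ 1` makes the denominator positive from `0 ≤ log C` alone.
  have hℓ' := hℓ.def (c := δ / (2 * (Real.log C + 1))) (by positivity)
  have hsq : ∀ᶠ N : ℕ in atTop, √((N : ℝ) ^ (1 - 2 * γ)) < δ / 4 :=
    (tendsto_natCast_rpow_one_sub hγ).eventually_lt_const (by linarith)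
  filter_upwards [hℓ', hsq, eventually_gt_atTop 1] with N h1 h2 hN
  refine ((B N).measure_logPotential_ge_le hN hγ (hG N) z δ hq0 hq1).trans
    (ENNReal.ofReal_le_ofReal ?_)
  rw [← hC]
  have hCℓ : C ^ (B N).ℓ ≤ Real.exp (δ / 2 * N) := by
    rw [Real.norm_natCast, Real.norm_natCast, div_mul_eq_mul_div,
      le_div_iff₀ (by positivity)] at h1
    rw [← Real.exp_log (zero_lt_one.trans_le hC1), ← Real.exp_nat_mul, Real.exp_le_exp]
    have : (0 : ℝ) ≤ (B N).ℓ := Nat.cast_nonneg _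
    linarith
  have hbase : (1 + √((N : ℝ) ^ (1 - 2 * γ))) ^ 2 / q ≤ Real.exp δ := by
    set s := √((N : ℝ) ^ (1 - 2 * γ))
    have hs : 0 ≤ s := Real.sqrt_nonneg _
    have h3 : 1 + s ≤ Real.exp (δ / 4) := by
      have := Real.add_one_le_exp (δ / 4)
      linarith
    rw [div_le_iff₀ hq0, hq, ← Real.exp_add]
    calc (1 + s) ^ 2 ≤ Real.exp (δ / 4) ^ 2 := by gcongr
      _ = Real.exp (δ + -(δ / 2)) := by
        rw [← Real.exp_nat_mul]
        congr 1
        push_cast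
        ring
  calc _ ≤ Real.exp (-(2 * N * δ)) * (Real.exp (δ / 2 * N) * Real.exp δ ^ N) := by
        gcongr
    _ = Real.exp (-(δ / 2 * N)) := by
        rw [← Real.exp_nat_mul, ← Real.exp_add, ← Real.exp_add]
        congr 1
        ring
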